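/- Let $m$ be a positive integer and $n = 7m$. Let $\mathcal F$ be a family of exactly $7m$ distinct $3$-element subsets of the $n$-element set of coordinates $[n]$ that covers every point with $(2,3)$-availability, i.e. for every $i \in [n]$ there are three distinct members of $\mathcal F$ that contain $i$ and pairwise intersect only in $i$ (exact covering). Let $\mathcal C \subseteq \mathbb F_2^{n}$ be the (primal) binary linear code spanned by the indicator vectors of the members of $\mathcal F$, and let $\mathcal C^{\perp}$ be its dual code for the standard dot product. Then the rate of the dual code satisfies $$\frac{\dim \mathcal C^{\perp}}{n} \le \frac{3}{7}.$$ Moreover, the following are equivalent, where codes are called equivalent if they agree up to a permutation of the coordinates: (i) $\dim \mathcal C^{\perp}/n = 3/7$; (ii) $\mathcal C^{\perp}$ is equivalent to a direct sum of $m$ copies of the $[7,3]$ Simplex code (the row space over $\mathbb F_2$ of the $3\times 7$ matrix whose columns are the nonzero vectors of $\mathbb F_2^3$); (iii) $\mathcal C$ is equivalent to a direct sum of $m$ copies of the $[7,4]$ Hamming code (the kernel over $\mathbb F_2$ of the same matrix). -/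

import Mathlib

/-- A binary linear code whose coordinates (points) are indexed by `ι`. -/
abbrev BinaryCode (ι : Type*) : Type _ := Submodule (ZMod 2) (ι → ZMod 2)

/-- The binary vector with support `S`. -/
def indicatorVec {ι : Type*} [DecidableEq ι] (S : Finset ι) : ι → ZMod 2 :=
  fun i => if i ∈ S then 1 else 0

/-- The code spanned by (the indicator vectors of) a family of subsets of the point set. -/
def codeSpannedBy {ι : Type*} [DecidableEq ι] (F : Finset (Finset ι)) : BinaryCode ι :=
  Submodule.span (ZMod 2) (indicatorVec '' (F : Set (Finset ι)))

/-- The dual code: all vectors orthogonal to every codeword for the standard dot product. -/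
def dualCode {ι : Type*} [Fintype ι] (C : BinaryCode ι) : BinaryCode ι where
  carrier := {x | ∀ c ∈ C, c ⬝ᵥ x = 0}
  zero_mem' := by
    intro c _
    simp
  add_mem' := by
    intro x y hx hy c hc
    rw [dotProduct_add, hx c hc, hy c hc, add_zero]
  smul_mem' := by
    intro a x hx c hc
    rw [dotProduct_smul, hx c hc, smul_zero]

/-- The rate `k / n` of a code of length `n` and dimension `k`. -/
noncomputable def codeRate {ι : Type*} [Fintype ι] (C : BinaryCode ι) : ℝ :=
  (Module.finrank (ZMod 2) C : ℝ) / (Fintype.card ι : ℝ)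

/-- The family `F` covers the point `i` with `(r, t)`-availability: `F` has (at least) `t` distinct
members of size at most `r + 1` that contain `i` and pairwise intersect only in `i`. -/
def CoversWithAvailability {ι : Type*} [DecidableEq ι] (r t : ℕ) (F : Finset (Finset ι)) (i : ι) :
    Prop :=
  ∃ T : Finset (Finset ι), T ⊆ F ∧ T.card = t ∧ (∀ S ∈ T, i ∈ S ∧ S.card ≤ r + 1) ∧
    ∀ S₁ ∈ T, ∀ S₂ ∈ T, S₁ ≠ S₂ → S₁ ∩ S₂ = {i}

/-- Two binary codes are equivalent if one arises from the other by a relabelling of the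
coordinates. -/
def CodeEquivalent {ι κ : Type*} (C : BinaryCode ι) (D : BinaryCode κ) : Prop :=
  ∃ e : ι ≃ κ, ∀ x : κ → ZMod 2, x ∈ D ↔ x ∘ e ∈ C

/-- The direct sum of `m` copies of `C`: the vectors formed by `m` blocks that all lie in `C`. -/
def directSumCopies {ι : Type*} (m : ℕ) (C : BinaryCode ι) : BinaryCode (Fin m × ι) where
  carrier := {x | ∀ j : Fin m, (fun i => x (j, i)) ∈ C}
  zero_mem' := fun _ => C.zero_mem
  add_mem' := fun hx hy j => C.add_mem (hx j) (hy j)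
  smul_mem' := fun a _ hx j => C.smul_mem a (hx j)

/-- The `3 × 7` binary matrix whose columns are the seven nonzero vectors of `𝔽₂³`. -/
def hammingMatrix : Matrix (Fin 3) (Fin 7) (ZMod 2) :=
  !![0, 0, 0, 1, 1, 1, 1;
     0, 1, 1, 0, 0, 1, 1;
     1, 0, 1, 0, 1, 0, 1]

/-- The `[7,3]` Simplex code: the row space of `hammingMatrix`. -/
def simplexCode : BinaryCode (Fin 7) :=
  Submodule.span (ZMod 2) (Set.range hammingMatrix.row)

/-- The `[7,4]` Hamming code: the code with parity-check matrix `hammingMatrix`. -/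
def hammingCode : BinaryCode (Fin 7) :=
  LinearMap.ker hammingMatrix.mulVecLin

/-! Double counting turns exact covering into a symmetric configuration of triples ("lines"), and
dual words are the vectors whose sum over every line is zero. Their dimension is bounded by forcing
zeros: vanishing on a line costs at most two dimensions, and vanishing at a further point of a line
that meets the zero set once costs at most one more. The zero set is always closed under lines. If
such an extension adds g points and f lines, then f ≤ g(g-1)/2 and f ≤ 3g/2.

The weights 14 per dimension, 5 per line and 11 per point solve 2·14 + 5 = 3·11 and 14 + 6·5 = 4·11:
they are tight for a first line followed by four points and six lines, that is, for a Fano plane.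
All other extensions leave slack. Summing (`finrank_bound`) gives 14 dim + 5|F| ≤ 11n.

In the equality case, the process started at any point must produce a Fano plane (`exists_isBlock`).
These planes partition the points, dual words restrict to simplex words on each, and a dimension
count identifies the codes. The Hamming statement follows by duality. -/

/-- A symmetric configuration of triples: every member has three points, every point lies on three
members, and two members that share two points agree. -/
structure IsTripleConfiguration {ι : Type*} [DecidableEq ι] (F : Finset (Finset ι)) : Prop where
  card_eq : ∀ S ∈ F, S.card = 3
  degree : ∀ i, (F.filter (i ∈ ·)).card = 3
  eq_of_mem : ∀ S ∈ F, ∀ T ∈ F, ∀ i ∈ S, ∀ j ∈ S, i ≠ j → i ∈ T → j ∈ T → S = T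

/-- A set of points is line-closed if it contains every line of which it contains two points. -/
def LineClosed {ι : Type*} [DecidableEq ι] (F : Finset (Finset ι)) (K : Finset ι) : Prop :=
  ∀ S ∈ F, 2 ≤ (S ∩ K).card → S ⊆ K

/-! ### Counting in a symmetric configuration. -/

section Config

variable {ι : Type*} [DecidableEq ι] {F : Finset (Finset ι)}

/-- There are three incidences per point on average and at least three at each point, so exactly
three. The availability witnesses are then all the lines through the point, which makes the
configuration linear. -/
theorem isTripleConfiguration_of_covers [Fintype ι] (hcard : F.card = Fintype.card ι)
    (hthree : ∀ S ∈ F, S.card = 3) (hcover : ∀ i, CoversWithAvailability 2 3 F i) :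
    IsTripleConfiguration F := by
  have hle : ∀ i, 3 ≤ (F.filter (i ∈ ·)).card := by
    intro i
    obtain ⟨T, hTF, hT, hmem, -⟩ := hcover i
    rw [← hT]
    exact Finset.card_le_card fun S hS => Finset.mem_filter.2 ⟨hTF hS, (hmem S hS).1⟩
  have hsum : ∑ i, (F.filter (i ∈ ·)).card = ∑ _i : ι, 3 := by
    have h2 := Finset.sum_card_bipartiteAbove_eq_sum_card_bipartiteBelow
      (s := (Finset.univ : Finset ι)) (t := F) (fun i S => i ∈ S)
    simp only [Finset.bipartiteAbove, Finset.bipartiteBelow, Finset.filter_univ_mem] at h2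
    rw [h2, Finset.sum_congr rfl hthree]
    simp [hcard]
  have hdeg : ∀ i, (F.filter (i ∈ ·)).card = 3 := fun i =>
    (((Finset.sum_eq_sum_iff_of_le fun i _ => hle i).1 hsum.symm) i (Finset.mem_univ i)).symm
  refine ⟨hthree, hdeg, ?_⟩
  intro S hS T hT i hiS j hjS hij hiT hjT
  obtain ⟨U, hUF, hU, hmem, hint⟩ := hcover i
  have hUe : U = F.filter (i ∈ ·) := Finset.eq_of_subset_of_card_le
    (fun S hS => Finset.mem_filter.2 ⟨hUF hS, (hmem S hS).1⟩) (by rw [hdeg, hU])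
  by_contra hne
  have h := hint S (by simp [hUe, hS, hiS]) T (by simp [hUe, hT, hiT]) hne
  have : j ∈ S ∩ T := Finset.mem_inter.2 ⟨hjS, hjT⟩
  rw [h, Finset.mem_singleton] at this
  exact hij this.symm

theorem two_mul_card_le_three_mul_card (hF : IsTripleConfiguration F) (L : Finset (Finset ι))
    (hL : L ⊆ F) (G : Finset ι) (h : ∀ S ∈ L, 2 ≤ (S ∩ G).card) : 2 * L.card ≤ 3 * G.card := by
  have h2 := Finset.sum_card_bipartiteAbove_eq_sum_card_bipartiteBelow
    (s := G) (t := L) (fun i S => i ∈ S)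
  calc 2 * L.card = ∑ _S ∈ L, 2 := by simp [mul_comm]
    _ ≤ ∑ S ∈ L, (G.filter (· ∈ S)).card := by
      refine Finset.sum_le_sum fun S hS => ?_
      rw [Finset.filter_mem_eq_inter, Finset.inter_comm]
      exact h S hS
    _ = ∑ i ∈ G, (L.filter (i ∈ ·)).card := h2.symm
    _ ≤ ∑ i ∈ G, 3 := Finset.sum_le_sum fun i _ => by
      rw [← hF.degree i]
      exact Finset.card_le_card (Finset.filter_subset_filter _ hL)
    _ = 3 * G.card := by simp [mul_comm]

/-- Distinct lines share no ordered pair of distinct points. For nonempty `G` this beats the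
incidence count only below four points. -/
theorem two_mul_card_le_card_offDiag (hF : IsTripleConfiguration F) (L : Finset (Finset ι))
    (hL : L ⊆ F) (G : Finset ι) (h : ∀ S ∈ L, 2 ≤ (S ∩ G).card) :
    2 * L.card ≤ G.card * G.card - G.card := by
  rw [← Finset.offDiag_card]
  calc 2 * L.card = ∑ _S ∈ L, 2 := by simp [mul_comm]
    _ ≤ ∑ S ∈ L, (S ∩ G).offDiag.card := by
      refine Finset.sum_le_sum fun S hS => ?_
      rw [Finset.offDiag_card]
      have := h S hS
      have h3 := Nat.mul_le_mul_right (S ∩ G).card this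
      omega
    _ = (L.biUnion fun S => (S ∩ G).offDiag).card := by
      refine (Finset.card_biUnion ?_).symm
      intro S hS T hT hne
      refine Finset.disjoint_left.2 ?_
      rintro ⟨i, j⟩ h1 h2
      simp only [Finset.mem_offDiag, Finset.mem_inter] at h1 h2
      exact hne (hF.eq_of_mem S (hL hS) T (hL hT) i h1.1.1 j h1.2.1.1 h1.2.2 h2.1.1 h2.2.1.1)
    _ ≤ G.offDiag.card := by
      refine Finset.card_le_card (Finset.biUnion_subset.2 fun S _ => ?_)
      exact Finset.offDiag_mono Finset.inter_subset_right

/-- A line through two points contains a third point. -/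
theorem exists_third_point {S : Finset ι} (h3 : S.card = 3) {a b : ι} (ha : a ∈ S) (hb : b ∈ S)
    (hab : a ≠ b) : ∃ c, c ≠ a ∧ c ≠ b ∧ S = {a, b, c} := by
  have h : ((S.erase a).erase b).card = 1 := by
    rw [Finset.card_erase_of_mem (Finset.mem_erase.2 ⟨hab.symm, hb⟩), Finset.card_erase_of_mem ha,
      h3]
  obtain ⟨c, hc⟩ := Finset.card_eq_one.1 h
  have hcm : c ∈ (S.erase a).erase b := by rw [hc]; simp
  simp only [Finset.mem_erase] at hcm
  refine ⟨c, hcm.2.1, hcm.1, ?_⟩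
  rw [← hc, Finset.insert_erase (Finset.mem_erase.2 ⟨hab.symm, hb⟩), Finset.insert_erase ha]

theorem lineClosed_line (hF : IsTripleConfiguration F) {S : Finset ι} (hS : S ∈ F) :
    LineClosed F S := by
  intro T hT h
  obtain ⟨i, hi, j, hj, hij⟩ := Finset.one_lt_card.1 (show 1 < (T ∩ S).card from h)
  rw [Finset.mem_inter] at hi hj
  rw [hF.eq_of_mem T hT S hS i hi.1 j hj.1 hij hi.2 hj.2]

/-- The counting step: a line-closed extension by `g ≥ 2` points that gains `f` lines satisfies
`14 + 5 f ≤ 11 g`, with equality only for `g = 4` and `f = 6`. -/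
theorem extension_count (hF : IsTripleConfiguration F) {K K' : Finset ι} (hKK' : K ⊆ K')
    (hK : LineClosed F K) (hg : K.card + 2 ≤ K'.card) :
    14 + 5 * (F.filter fun S => ¬ S ⊆ K).card + 11 * K.card ≤
        5 * (F.filter fun S => ¬ S ⊆ K').card + 11 * K'.card ∧
      (5 * (F.filter fun S => ¬ S ⊆ K').card + 11 * K'.card ≤
          14 + 5 * (F.filter fun S => ¬ S ⊆ K).card + 11 * K.card →
        K'.card = K.card + 4 ∧ (F.filter fun S => ¬ S ⊆ K).card =
          (F.filter fun S => ¬ S ⊆ K').card + 6) := by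
  set L := F.filter fun S => ¬ S ⊆ K ∧ S ⊆ K' with hLdef
  have hsplit : (F.filter fun S => ¬ S ⊆ K).card =
      (F.filter fun S => ¬ S ⊆ K').card + L.card := by
    rw [← Finset.card_union_of_disjoint]
    · congr 1
      ext S
      simp only [hLdef, Finset.mem_filter, Finset.mem_union]
      have : S ⊆ K → S ⊆ K' := fun h => h.trans hKK'
      tauto
    · rw [Finset.disjoint_left]
      intro S h1 h2
      simp only [hLdef, Finset.mem_filter] at h1 h2
      exact h1.2 h2.2.2
  have hG : (K' \ K).card + K.card = K'.card := Finset.card_sdiff_add_card_eq_card hKK'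
  -- A new line has at most one point in the line-closed `K`, hence at least two new ones.
  have hL2 : ∀ S ∈ L, 2 ≤ (S ∩ (K' \ K)).card := by
    intro S hS
    obtain ⟨hSF, hSK, hSK'⟩ := Finset.mem_filter.1 hS
    have h1 : (S ∩ K).card < 2 := by
      by_contra h
      exact hSK (hK S hSF (not_lt.1 h))
    have h2 : S ∩ (K' \ K) = S \ K := by
      ext i
      simp only [Finset.mem_inter, Finset.mem_sdiff]
      exact ⟨fun h => ⟨h.1, h.2.2⟩, fun h => ⟨h.1, hSK' h.1, h.2⟩⟩
    have h3 := Finset.card_sdiff_add_card_inter S K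
    rw [h2]
    have := hF.card_eq S hSF
    omega
  have b1 := two_mul_card_le_three_mul_card hF L (Finset.filter_subset _ _) _ hL2
  have b2 := two_mul_card_le_card_offDiag hF L (Finset.filter_subset _ _) _ hL2
  generalize (K' \ K).card = g at *
  generalize L.card = f at *
  rw [hsplit]
  have hg2 : 2 ≤ g := by omega
  -- Pairs give f ≤ 1, 3 for g = 2, 3; from g = 4 on, 2f ≤ 3g suffices.
  rcases Nat.lt_or_ge g 4 with h | h
  · interval_cases g <;> omega
  · omega

/-- A block: seven points such that every line that meets them lies inside. -/
def IsBlock (F : Finset (Finset ι)) (B : Finset ι) : Prop :=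
  B.card = 7 ∧ ∀ S ∈ F, ∀ i ∈ S, i ∈ B → S ⊆ B

/-- The three lines through `i` have six distinct further points, which exhaust the block; blocks
are thus Fano planes. -/
theorem IsBlock.exists_line (hF : IsTripleConfiguration F) {B : Finset ι} (hB : IsBlock F B)
    {i j : ι} (hi : i ∈ B) (hj : j ∈ B) : ∃ S ∈ F, i ∈ S ∧ j ∈ S := by
  have hcov : (F.filter (i ∈ ·)).biUnion (fun S => S.erase i) = B.erase i := by
    refine Finset.eq_of_subset_of_card_le (Finset.biUnion_subset.2 fun S hS => ?_) ?_
    · rw [Finset.mem_filter] at hS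
      exact Finset.erase_subset_erase _ (hB.2 S hS.1 i hS.2 hi)
    · rw [Finset.card_erase_of_mem hi, hB.1, Finset.card_biUnion]
      · rw [Finset.sum_congr rfl (g := fun _ => 2)]
        · simp [hF.degree]
        · intro S hS
          rw [Finset.mem_filter] at hS
          rw [Finset.card_erase_of_mem hS.2, hF.card_eq S hS.1]
      · intro S hS T hT hne
        rw [Finset.mem_coe, Finset.mem_filter] at hS hT
        refine Finset.disjoint_left.2 fun k hk hk' => ?_
        rw [Finset.mem_erase] at hk hk'
        exact hne (hF.eq_of_mem S hS.1 T hT.1 i hS.2 k hk.2 hk.1.symm hT.2 hk'.2)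
  by_cases hij : j = i
  · subst hij
    obtain ⟨S, hS⟩ : (F.filter (j ∈ ·)).Nonempty :=
      Finset.card_pos.1 (by rw [hF.degree]; norm_num)
    rw [Finset.mem_filter] at hS
    exact ⟨S, hS.1, hS.2, hS.2⟩
  · have : j ∈ B.erase i := Finset.mem_erase.2 ⟨hij, hj⟩
    rw [← hcov, Finset.mem_biUnion] at this
    obtain ⟨S, hS, hjS⟩ := this
    rw [Finset.mem_filter] at hS
    exact ⟨S, hS.1, hS.2, (Finset.mem_erase.1 hjS).2⟩

end Config

/-! ### The dimension bound and its equality case. -/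

theorem finrank_le_finrank_inf_ker_proj_add_one {ι : Type*} [Fintype ι] (W : BinaryCode ι) (p : ι) :
    Module.finrank (ZMod 2) W ≤
      Module.finrank (ZMod 2) (W ⊓ LinearMap.ker (LinearMap.proj p :
        (ι → ZMod 2) →ₗ[ZMod 2] ZMod 2) : BinaryCode ι) + 1 := by
  set φ : (ι → ZMod 2) →ₗ[ZMod 2] ZMod 2 := LinearMap.proj p
  have h := LinearMap.finrank_range_add_finrank_ker (φ.domRestrict W)
  have h1 : Module.finrank (ZMod 2) (LinearMap.range (φ.domRestrict W)) ≤ 1 := by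
    simpa using Submodule.finrank_le (LinearMap.range (φ.domRestrict W))
  have h2 : Module.finrank (ZMod 2) (LinearMap.ker (φ.domRestrict W)) =
      Module.finrank (ZMod 2) (W ⊓ LinearMap.ker φ : BinaryCode ι) := by
    rw [LinearMap.domRestrict, LinearMap.ker_comp, ← Submodule.map_comap_subtype]
    exact (LinearEquiv.finrank_eq (Submodule.equivMapOfInjective _ W.injective_subtype _))
  omega

section Bound

variable {ι : Type*} [DecidableEq ι] [Fintype ι] {F : Finset (Finset ι)}

open scoped Classical in
/-- The coordinates that vanish on all words of `W`. -/
noncomputable def zeroCoords (W : BinaryCode ι) : Finset ι :=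
  Finset.univ.filter fun i => ∀ x ∈ W, x i = 0

theorem mem_zeroCoords {W : BinaryCode ι} {i : ι} : i ∈ zeroCoords W ↔ ∀ x ∈ W, x i = 0 := by
  simp [zeroCoords]

theorem lineClosed_zeroCoords (h3 : ∀ S ∈ F, S.card = 3) {W : BinaryCode ι}
    (hW : ∀ x ∈ W, ∀ S ∈ F, ∑ i ∈ S, x i = 0) : LineClosed F (zeroCoords W) := by
  intro S hS h k hk
  rw [mem_zeroCoords]
  intro x hx
  have hsum := hW x hx S hS
  by_contra hne
  have hk' : k ∉ zeroCoords W := fun h => hne (mem_zeroCoords.1 h x hx)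
  have hsub : S.erase k ⊆ zeroCoords W := by
    have h1 : S ∩ zeroCoords W ⊆ S.erase k := by
      intro i hi
      rw [Finset.mem_inter] at hi
      exact Finset.mem_erase.2 ⟨fun e => hk' (e ▸ hi.2), hi.1⟩
    have h2 := Finset.eq_of_subset_of_card_le h1 (by
      rw [Finset.card_erase_of_mem hk, h3 S hS]; exact h)
    rw [← h2]
    exact Finset.inter_subset_right
  rw [← Finset.add_sum_erase S x hk,
    Finset.sum_eq_zero fun i hi => mem_zeroCoords.1 (hsub hi) x hx, add_zero] at hsum
  exact hne hsum

/-- Adjoining a point of a line that meets `K` in one point yields a line-closed set with at least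
two more points, at the cost of at most one dimension. -/
theorem exists_lineClosed_extension (hF : IsTripleConfiguration F) {W : BinaryCode ι}
    (hW : ∀ x ∈ W, ∀ S ∈ F, ∑ i ∈ S, x i = 0) {K : Finset ι} (hKW : K ⊆ zeroCoords W)
    {S : Finset ι} (hS : S ∈ F) (hSK : (S ∩ K).card = 1) :
    ∃ W' ≤ W, Module.finrank (ZMod 2) W ≤ Module.finrank (ZMod 2) W' + 1 ∧
      K ⊆ zeroCoords W' ∧ S ⊆ zeroCoords W' ∧ LineClosed F (zeroCoords W') ∧
      K.card + 2 ≤ (zeroCoords W').card := by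
  have h3 := Finset.card_sdiff_add_card_inter S K
  rw [hF.card_eq S hS, hSK] at h3
  obtain ⟨p, hp⟩ : (S \ K).Nonempty := Finset.card_pos.1 (by omega)
  rw [Finset.mem_sdiff] at hp
  set W' : BinaryCode ι := W ⊓ LinearMap.ker (LinearMap.proj p :
        (ι → ZMod 2) →ₗ[ZMod 2] ZMod 2)
  have hle : W' ≤ W := inf_le_left
  have hK : K ⊆ zeroCoords W' := fun i hi =>
    mem_zeroCoords.2 fun x hx => mem_zeroCoords.1 (hKW hi) x (hle hx)
  have hpK : p ∈ zeroCoords W' := mem_zeroCoords.2 fun x hx => hx.2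
  have hcl : LineClosed F (zeroCoords W') :=
    lineClosed_zeroCoords hF.card_eq fun x hx => hW x (hle hx)
  have hSs : S ⊆ zeroCoords W' := by
    refine hcl S hS ?_
    have : insert p (S ∩ K) ⊆ S ∩ zeroCoords W' := by
      intro i hi
      rcases Finset.mem_insert.1 hi with rfl | hi
      · exact Finset.mem_inter.2 ⟨hp.1, hpK⟩
      · exact Finset.mem_inter.2 ⟨(Finset.mem_inter.1 hi).1, hK (Finset.mem_inter.1 hi).2⟩
    have h := Finset.card_le_card this
    rw [Finset.card_insert_of_notMem (fun h => hp.2 (Finset.mem_inter.1 h).2), hSK] at h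
    exact h
  refine ⟨W', hle, finrank_le_finrank_inf_ker_proj_add_one W p, hK, hSs, hcl, ?_⟩
  have h := Finset.card_le_card (Finset.union_subset hK (Finset.sdiff_subset.trans hSs : S \ K ⊆ _))
  rw [Finset.card_union_of_disjoint Finset.disjoint_sdiff] at h
  omega

/-- Passing to the words that vanish on a line costs at most two dimensions. -/
theorem exists_vanishing_on_line {W : BinaryCode ι} (hW : ∀ x ∈ W, ∀ S ∈ F, ∑ i ∈ S, x i = 0)
    {S : Finset ι} (hS : S ∈ F) (h3 : S.card = 3) :
    ∃ W' ≤ W, Module.finrank (ZMod 2) W ≤ Module.finrank (ZMod 2) W' + 2 ∧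
      S ⊆ zeroCoords W' := by
  obtain ⟨a, b, c, hab, hac, hbc, rfl⟩ := Finset.card_eq_three.1 h3
  have h1 := finrank_le_finrank_inf_ker_proj_add_one W a
  set W₁ : BinaryCode ι := W ⊓ LinearMap.ker (LinearMap.proj a :
        (ι → ZMod 2) →ₗ[ZMod 2] ZMod 2)
  have h2 := finrank_le_finrank_inf_ker_proj_add_one W₁ b
  refine ⟨W₁ ⊓ LinearMap.ker (LinearMap.proj b : (ι → ZMod 2) →ₗ[ZMod 2] ZMod 2),
    inf_le_left.trans inf_le_left, by omega, ?_⟩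
  intro i hi
  rw [mem_zeroCoords]
  intro x hx
  have ha : x a = 0 := hx.1.2
  have hb : x b = 0 := hx.2
  have hs := hW x hx.1.1 _ hS
  rw [Finset.sum_insert (by simp [hab, hac]), Finset.sum_insert (by simp [hbc]),
    Finset.sum_singleton, ha, hb, zero_add, zero_add] at hs
  simp only [Finset.mem_insert, Finset.mem_singleton] at hi
  rcases hi with rfl | rfl | rfl <;> assumption

/-- Induction on the number of points outside `K`. The set `K` may be smaller than the zero set, so
that a disjoint line can be added as exactly three points and one line. -/
theorem finrank_bound (hF : IsTripleConfiguration F) :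
    ∀ (d : ℕ) (K : Finset ι) (W : BinaryCode ι), Kᶜ.card ≤ d → LineClosed F K →
      (∀ x ∈ W, ∀ S ∈ F, ∑ i ∈ S, x i = 0) → K ⊆ zeroCoords W →
      14 * Module.finrank (ZMod 2) W + 5 * (F.filter fun S => ¬ S ⊆ K).card + 11 * K.card ≤
        11 * Fintype.card ι := by
  intro d
  induction d with
  | zero =>
    intro K W hd hK hW hKW
    have hKu : K = Finset.univ := by simpa using hd
    have hW0 : W = ⊥ := by
      refine (Submodule.eq_bot_iff _).2 fun x hx => funext fun i => ?_
      exact mem_zeroCoords.1 (hKW (hKu ▸ Finset.mem_univ i)) x hx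
    subst hW0 hKu
    simp
  | succ d ih =>
    intro K W hd hK hW hKW
    by_cases hu : K = Finset.univ
    · exact ih K W (by simp [hu]) hK hW hKW
    have hcompl : ∀ K' : Finset ι, K.card < K'.card → K'ᶜ.card ≤ d := by
      intro K' h
      have h1 := Finset.card_add_card_compl K
      have h2 := Finset.card_add_card_compl K'
      omega
    by_cases hA : ∃ S ∈ F, (S ∩ K).card = 1
    · obtain ⟨S, hS, hSK⟩ := hA
      obtain ⟨W', hle, hrank, hKK', -, hcl, hcard⟩ := exists_lineClosed_extension hF hW hKW hS hSK
      have h1 := ih (zeroCoords W') W' (hcompl _ (by omega)) hcl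
        (fun x hx => hW x (hle hx)) subset_rfl
      have h2 := (extension_count hF hKK' hK hcard).1
      omega
    · push Not at hA
      obtain ⟨p, hp⟩ : ∃ p, p ∉ K := by
        by_contra! h
        exact hu (Finset.eq_univ_iff_forall.2 h)
      -- No line meets `K` once, so every line outside `K` is disjoint from it. Adding one then
      -- balances exactly: 2·14 + 5 = 3·11.
      have hall : ∀ S ∈ F, ¬ S ⊆ K → Disjoint S K := by
        intro S hS hSK
        rw [Finset.disjoint_iff_inter_eq_empty, ← Finset.card_eq_zero]
        have h1 := hA S hS
        have h2 : ¬ 2 ≤ (S ∩ K).card := fun h => hSK (hK S hS h)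
        omega
      obtain ⟨ℓ, hℓ⟩ : (F.filter (p ∈ ·)).Nonempty :=
        Finset.card_pos.1 (by rw [hF.degree]; norm_num)
      rw [Finset.mem_filter] at hℓ
      have hℓK : ¬ ℓ ⊆ K := fun h => hp (h hℓ.2)
      have hdisj := hall ℓ hℓ.1 hℓK
      have h3 := hF.card_eq ℓ hℓ.1
      obtain ⟨W', hle, hrank, hℓW⟩ := exists_vanishing_on_line hW hℓ.1 h3
      have hcard : (K ∪ ℓ).card = K.card + 3 := by
        rw [Finset.card_union_of_disjoint hdisj.symm, h3]
      have hnew : ∀ S ∈ F, S ≠ ℓ → ¬ S ⊆ K → (S ∩ (K ∪ ℓ)).card < 2 := by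
        intro S hS hne hSK
        by_contra! h
        rw [Finset.inter_union_distrib_left,
          Finset.disjoint_iff_inter_eq_empty.1 (hall S hS hSK), Finset.empty_union] at h
        have h4 := lineClosed_line hF hℓ.1 S hS h
        exact hne (Finset.eq_of_subset_of_card_le h4 (by rw [h3, hF.card_eq S hS]))
      have hcl : LineClosed F (K ∪ ℓ) := by
        intro S hS h
        by_cases he : S = ℓ
        · exact he ▸ Finset.subset_union_right
        by_cases hSK : S ⊆ K
        · exact hSK.trans Finset.subset_union_left
        · exact absurd h (not_le.2 (hnew S hS he hSK))
      have hlines : (F.filter fun S => ¬ S ⊆ K) =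
          insert ℓ (F.filter fun S => ¬ S ⊆ K ∪ ℓ) := by
        ext S
        simp only [Finset.mem_filter, Finset.mem_insert]
        constructor
        · rintro ⟨hS, hSK⟩
          by_cases he : S = ℓ
          · exact Or.inl he
          · refine Or.inr ⟨hS, fun hsub => ?_⟩
            have := hnew S hS he hSK
            rw [Finset.inter_eq_left.2 hsub, hF.card_eq S hS] at this
            omega
        · rintro (rfl | ⟨hS, hSK⟩)
          · exact ⟨hℓ.1, hℓK⟩
          · exact ⟨hS, fun h => hSK (h.trans Finset.subset_union_left)⟩
      have hlc : (F.filter fun S => ¬ S ⊆ K).card = (F.filter fun S => ¬ S ⊆ K ∪ ℓ).card + 1 := by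
        rw [hlines, Finset.card_insert_of_notMem]
        simp [Finset.subset_union_right]
      have h1 := ih (K ∪ ℓ) W' (hcompl _ (by omega)) hcl (fun x hx => hW x (hle hx))
        (Finset.union_subset (fun i hi => mem_zeroCoords.2 fun x hx =>
          mem_zeroCoords.1 (hKW hi) x (hle hx)) hℓW)
      omega

theorem fourteen_mul_finrank_le (hF : IsTripleConfiguration F) {W : BinaryCode ι}
    (hW : ∀ x ∈ W, ∀ S ∈ F, ∑ i ∈ S, x i = 0) :
    14 * Module.finrank (ZMod 2) W + 5 * F.card ≤ 11 * Fintype.card ι := by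
  have h := finrank_bound hF _ ∅ W le_rfl (fun S _ h => by simp at h) hW (by simp)
  have he : (F.filter fun S => ¬ S ⊆ ∅) = F := by
    refine Finset.filter_true_of_mem fun S hS h => ?_
    have := hF.card_eq S hS
    simp [Finset.subset_empty.1 h] at this
  rw [he] at h
  simpa using h

theorem exists_isBlock (hF : IsTripleConfiguration F) {W : BinaryCode ι}
    (hW : ∀ x ∈ W, ∀ S ∈ F, ∑ i ∈ S, x i = 0)
    (heq : 14 * Module.finrank (ZMod 2) W + 5 * F.card = 11 * Fintype.card ι) (i : ι) :
    ∃ B, IsBlock F B ∧ i ∈ B := by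
  obtain ⟨ℓ, hℓ, ℓ', hℓ', hne⟩ :=
    Finset.one_lt_card.1 (show 1 < (F.filter (i ∈ ·)).card by rw [hF.degree]; norm_num)
  rw [Finset.mem_filter] at hℓ hℓ'
  have h3 := hF.card_eq ℓ hℓ.1
  obtain ⟨W₁, hle₁, hrank₁, hℓW⟩ := exists_vanishing_on_line hW hℓ.1 h3
  have hmeet : (ℓ' ∩ ℓ).card = 1 := by
    have h1 : 0 < (ℓ' ∩ ℓ).card := Finset.card_pos.2 ⟨i, Finset.mem_inter.2 ⟨hℓ'.2, hℓ.2⟩⟩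
    have h2 : ¬ 2 ≤ (ℓ' ∩ ℓ).card := fun h => hne
      (Finset.eq_of_subset_of_card_le (lineClosed_line hF hℓ.1 ℓ' hℓ'.1 h)
        (by rw [h3, hF.card_eq ℓ' hℓ'.1])).symm
    omega
  have hW₁ : ∀ x ∈ W₁, ∀ S ∈ F, ∑ i ∈ S, x i = 0 := fun x hx => hW x (hle₁ hx)
  obtain ⟨W₂, hle₂, hrank₂, hKK', -, hcl, hcard⟩ :=
    exists_lineClosed_extension hF hW₁ hℓW hℓ'.1 hmeet
  have hb := finrank_bound hF _ (zeroCoords W₂) W₂ le_rfl hcl (fun x hx => hW₁ x (hle₂ hx))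
    subset_rfl
  have hone : (F.filter fun S => ¬ S ⊆ ℓ).card + 1 = F.card := by
    have : (F.filter fun S => ¬ S ⊆ ℓ) = F.erase ℓ := by
      ext S
      simp only [Finset.mem_filter, Finset.mem_erase]
      constructor
      · rintro ⟨hS, h⟩
        exact ⟨fun e => h e.subset, hS⟩
      · rintro ⟨hS, h⟩
        exact ⟨h, fun hs => hS (Finset.eq_of_subset_of_card_le hs (by rw [h3, hF.card_eq S h]))⟩
    rw [this, Finset.card_erase_add_one hℓ.1]
  -- The first line is exactly balanced, so global equality leaves no slack for this extension.
  obtain ⟨h4, h6⟩ := (extension_count hF hKK' (lineClosed_line hF hℓ.1) hcard).2 (by omega)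
  set B := zeroCoords W₂
  have hB : B.card = 7 := by omega
  have hL : (F.filter fun S => S ⊆ B).card = 7 := by
    have := Finset.card_filter_add_card_filter_not (s := F) (fun S => S ⊆ B)
    omega
  refine ⟨B, ⟨hB, ?_⟩, hKK' hℓ.2⟩
  -- Seven lines inside `B` make 21 = 7·3 incidences, so no line through a point of `B` leaves `B`.
  have h2 := Finset.sum_card_bipartiteAbove_eq_sum_card_bipartiteBelow
    (s := B) (t := F.filter fun S => S ⊆ B) (fun i S => i ∈ S)
  have hr : ∑ S ∈ F.filter (fun S => S ⊆ B), (B.filter (· ∈ S)).card = 21 := by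
    rw [Finset.sum_congr rfl (g := fun _ => 3)]
    · simp [hL]
    · intro S hS
      rw [Finset.mem_filter] at hS
      rw [Finset.filter_mem_eq_inter, Finset.inter_eq_right.2 hS.2, hF.card_eq S hS.1]
  have hsub : ∀ j, (F.filter fun S => S ⊆ B).filter (j ∈ ·) ⊆ F.filter (j ∈ ·) :=
    fun j => Finset.filter_subset_filter _ (Finset.filter_subset _ _)
  have hall : ∀ j ∈ B, ((F.filter fun S => S ⊆ B).filter (j ∈ ·)).card = 3 := by
    refine (Finset.sum_eq_sum_iff_of_le fun j _ => ?_).1 ?_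
    · rw [← hF.degree j]
      exact Finset.card_le_card (hsub j)
    · refine (h2.trans hr).trans ?_
      simp [hB]
  intro S hS j hjS hjB
  have he := Finset.eq_of_subset_of_card_le (hsub j) (by rw [hF.degree, hall j hjB])
  have hm : S ∈ F.filter (j ∈ ·) := Finset.mem_filter.2 ⟨hS, hjS⟩
  rw [← he] at hm
  exact (Finset.mem_filter.1 (Finset.mem_filter.1 hm).1).2

end Bound

/-! ### Fano coordinates on a block. -/

section Labelling

variable {ι : Type*} [DecidableEq ι] {F : Finset (Finset ι)}

theorem IsBlock.eq_of_mem (hF : IsTripleConfiguration F) {B B' : Finset ι} (hB : IsBlock F B)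
    (hB' : IsBlock F B') {i : ι} (hi : i ∈ B) (hi' : i ∈ B') : B = B' := by
  refine Finset.eq_of_subset_of_card_le (fun j hj => ?_) (by rw [hB.1, hB'.1])
  obtain ⟨S, hS, hiS, hjS⟩ := hB.exists_line hF hi hj
  exact hB'.2 S hS i hiS hi' hjS

/-- Coordinates 0, 1, 3 carry the unit columns of `hammingMatrix`, so they are the coefficients of
the rows. -/
theorem mem_simplexCode_of_eqs {x : Fin 7 → ZMod 2} (h2 : x 2 = x 0 + x 1) (h4 : x 4 = x 0 + x 3)
    (h5 : x 5 = x 1 + x 3) (h6 : x 6 = x 2 + x 3) : x ∈ simplexCode := by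
  have hx : x = x 3 • hammingMatrix.row 0 + x 1 • hammingMatrix.row 1 +
      x 0 • hammingMatrix.row 2 := by
    funext k
    fin_cases k <;> simp [hammingMatrix, Matrix.row, h2, h4, h5, h6] <;> ring
  rw [hx]
  refine add_mem (add_mem ?_ ?_) ?_ <;>
    exact Submodule.smul_mem _ _ (Submodule.subset_span ⟨_, rfl⟩)

theorem IsBlock.exists_labelling (hF : IsTripleConfiguration F) {B : Finset ι} (hB : IsBlock F B) :
    ∃ v : Fin 7 → ι, Function.Injective v ∧ (∀ k, v k ∈ B) ∧
      ∀ x : ι → ZMod 2, (∀ S ∈ F, ∑ i ∈ S, x i = 0) → x ∘ v ∈ simplexCode := by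
  obtain ⟨a, ha⟩ : B.Nonempty := Finset.card_pos.1 (by rw [hB.1]; norm_num)
  obtain ⟨S, hS, haS, -⟩ := hB.exists_line hF ha ha
  have hSB := hB.2 S hS a haS ha
  obtain ⟨b, hbS, hba⟩ : ∃ b ∈ S, b ≠ a :=
    Finset.exists_mem_ne (by rw [hF.card_eq S hS]; norm_num) a
  obtain ⟨c, hca, hcb, rfl⟩ := exists_third_point (hF.card_eq S hS) haS hbS hba.symm
  obtain ⟨p, hpB, hpS⟩ : ∃ p ∈ B, p ∉ ({a, b, c} : Finset ι) := by
    by_contra! h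
    have := Finset.card_le_card (show B ⊆ _ from h)
    rw [hB.1, hF.card_eq _ hS] at this
    omega
  have hline : ∀ q ∈ ({a, b, c} : Finset ι), ∃ r, r ≠ p ∧ r ≠ q ∧ r ∈ B ∧ {p, q, r} ∈ F ∧
      r ∉ ({a, b, c} : Finset ι) := by
    intro q hq
    obtain ⟨T, hT, hpT, hqT⟩ := hB.exists_line hF hpB (hSB hq)
    have hpq : p ≠ q := fun h => hpS (h ▸ hq)
    obtain ⟨r, hrp, hrq, rfl⟩ := exists_third_point (hF.card_eq T hT) hpT hqT hpq
    refine ⟨r, hrp, hrq, hB.2 _ hT p hpT hpB (by simp), hT, fun hr => hpS ?_⟩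
    rw [← hF.eq_of_mem _ hT _ hS r (by simp) q hqT hrq hr hq]
    exact hpT
  -- If the lines from `p` to two points of `{a, b, c}` shared `r` as well, they would coincide and
  -- contain two points of `{a, b, c}`, forcing `p` onto it.
  have hdistinct : ∀ q ∈ ({a, b, c} : Finset ι), ∀ q' ∈ ({a, b, c} : Finset ι), q ≠ q' →
      ∀ r r', r ≠ p → {p, q, r} ∈ F → {p, q', r'} ∈ F → r ≠ r' := by
    rintro q hq q' hq' hqq r r' hrp h h' rfl
    have he := hF.eq_of_mem _ h _ h' p (by simp) r (by simp) hrp.symm (by simp) (by simp)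
    have hq'' : q' ∈ ({p, q, r} : Finset ι) := by rw [he]; simp
    have := hF.eq_of_mem _ h _ hS q (by simp) q' hq'' hqq hq hq'
    exact hpS (this ▸ by simp)
  obtain ⟨d, hdp, hda, hdB, hdF, hdS⟩ := hline a (by simp)
  obtain ⟨e, hep, heb, heB, heF, heS⟩ := hline b (by simp)
  obtain ⟨f, hfp, hfc, hfB, hfF, hfS⟩ := hline c (by simp)
  have hde := hdistinct a (by simp) b (by simp) hba.symm d e hdp hdF heF
  have hdf := hdistinct a (by simp) c (by simp) hca.symm d f hdp hdF hfF
  have hef := hdistinct b (by simp) c (by simp) hcb.symm e f hep heF hfF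
  simp only [Finset.mem_insert, Finset.mem_singleton, not_or] at hpS hdS heS hfS
  have hsum : ∀ x : ι → ZMod 2, (∀ S ∈ F, ∑ i ∈ S, x i = 0) → ∀ q r s, q ≠ r → s ≠ q → s ≠ r →
      {q, r, s} ∈ F → x s = x q + x r := by
    intro x hx q r s hqr hsq hsr h
    have h0 := hx _ h
    rw [Finset.sum_insert (by simp [hqr, hsq.symm]), Finset.sum_insert (by simp [hsr.symm]),
      Finset.sum_singleton, ← add_assoc] at h0
    rw [← CharTwo.add_eq_zero, add_comm, h0]
  -- The order follows the columns: `a`, `b`, `p` are unit vectors, and the other labels are the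
  -- sums along four lines.
  refine ⟨![a, b, c, p, d, e, f], ?_, ?_, ?_⟩
  · intro k l hkl
    fin_cases k <;> fin_cases l <;> first | rfl | (exfalso; simp at hkl; grind)
  · intro k
    fin_cases k <;> simp <;> first | assumption | exact hSB (by simp)
  · intro x hx
    refine mem_simplexCode_of_eqs (hsum x hx a b c hba.symm hca hcb hS) ?_ ?_ ?_
    · exact (hsum x hx p a d (hpS.1) hdp hda hdF).trans (add_comm _ _)
    · exact (hsum x hx p b e (hpS.2.1) hep heb heF).trans (add_comm _ _)
    · exact (hsum x hx p c f (hpS.2.2) hfp hfc hfF).trans (add_comm _ _)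

end Labelling

/-! ### Equivalence, duality and direct sums of codes. -/

section Codes

variable {ι κ : Type*}

theorem CodeEquivalent.finrank_eq {C : BinaryCode ι} {D : BinaryCode κ} (h : CodeEquivalent C D) :
    Module.finrank (ZMod 2) C = Module.finrank (ZMod 2) D := by
  obtain ⟨e, he⟩ := h
  have hD : D = C.comap (LinearEquiv.funCongrLeft (ZMod 2) (ZMod 2) e).toLinearMap := by
    ext x
    exact he x
  rw [hD, Submodule.comap_equiv_eq_map_symm]
  exact (LinearEquiv.finrank_map_eq _ _).symm

theorem CodeEquivalent.dual [Fintype ι] [Fintype κ] {C : BinaryCode ι} {D : BinaryCode κ}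
    (h : CodeEquivalent C D) : CodeEquivalent (dualCode C) (dualCode D) := by
  obtain ⟨e, he⟩ := h
  refine ⟨e, fun x => ⟨fun hx c hc => ?_, fun hx c hc => ?_⟩⟩
  · have h := hx (c ∘ e.symm) ((he _).2 (by simpa [Function.comp_assoc] using hc))
    rw [← h, comp_equiv_symm_dotProduct]
  · have h := hx (c ∘ e) ((he c).1 hc)
    rw [← h]
    exact (comp_equiv_dotProduct_comp_equiv c x e).symm

theorem dualCode_dualCode [Fintype ι] (C : BinaryCode ι) : dualCode (dualCode C) = C := by
  classical
  set B : LinearMap.BilinForm (ZMod 2) (ι → ZMod 2) := dotProductBilin (ZMod 2) (ZMod 2) with hB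
  have hBa : ∀ x y, B x y = x ⬝ᵥ y := fun x y => rfl
  have hsymm : B.IsSymm := ⟨fun x y => by simp [hBa, dotProduct_comm]⟩
  have hnd : B.Nondegenerate :=
    (hsymm.isRefl.nondegenerate_iff_separatingLeft).2 fun x hx => dotProduct_eq_zero x hx
  have horth : ∀ D : BinaryCode ι, dualCode D = B.orthogonal D := by
    intro D
    ext x
    rfl
  rw [horth, horth, LinearMap.BilinForm.orthogonal_orthogonal hnd hsymm.isRefl]

theorem finrank_directSumCopies [Finite ι] (m : ℕ) (C : BinaryCode ι) :
    Module.finrank (ZMod 2) (directSumCopies m C) = m * Module.finrank (ZMod 2) C := by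
  let e : directSumCopies m C ≃ₗ[ZMod 2] (Fin m → C) :=
    { toFun := fun x j => ⟨fun i => x.1 (j, i), x.2 j⟩
      invFun := fun y => ⟨fun p => (y p.1).1 p.2, fun j => (y j).2⟩
      map_add' := fun _ _ => rfl
      map_smul' := fun _ _ => rfl
      left_inv := fun _ => rfl
      right_inv := fun _ => rfl }
  rw [e.finrank_eq, Module.finrank_pi_fintype]
  simp

theorem dualCode_directSumCopies [Fintype ι] (m : ℕ) (C : BinaryCode ι) :
    dualCode (directSumCopies m C) = directSumCopies m (dualCode C) := by
  ext x
  constructor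
  · intro hx j c hc
    have h := hx (fun p => if p.1 = j then c p.2 else 0) (fun k => by
      by_cases hk : k = j
      · simpa [hk] using hc
      · simp only [hk, if_false]
        exact C.zero_mem)
    rw [← h]
    simp [dotProduct, Fintype.sum_prod_type, ite_mul, Finset.sum_ite_irrel]
  · intro hx c hc
    rw [dotProduct, Fintype.sum_prod_type]
    exact Finset.sum_eq_zero fun j _ => hx j _ (hc j)

theorem dualCode_simplexCode : dualCode simplexCode = hammingCode := by
  ext x
  constructor
  · intro hx
    funext k
    exact hx _ (Submodule.subset_span ⟨k, rfl⟩)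
  · intro hx c hc
    induction hc using Submodule.span_induction with
    | mem c hc =>
      obtain ⟨k, rfl⟩ := hc
      exact congrFun hx k
    | zero => simp
    | add a b _ _ ha hb => rw [add_dotProduct, ha, hb, add_zero]
    | smul r a _ ha => rw [smul_dotProduct, ha, smul_zero]

theorem finrank_simplexCode : Module.finrank (ZMod 2) simplexCode = 3 := by
  rw [simplexCode, finrank_span_eq_card, Fintype.card_fin]
  rw [Fintype.linearIndependent_iff]
  intro g hg
  have h0 := congrFun hg 0
  have h1 := congrFun hg 1
  have h3 := congrFun hg 3
  simp [Fin.sum_univ_three, hammingMatrix, Matrix.row] at h0 h1 h3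
  intro i
  fin_cases i <;> assumption

theorem dotProduct_indicatorVec [Fintype ι] [DecidableEq ι] (S : Finset ι) (x : ι → ZMod 2) :
    indicatorVec S ⬝ᵥ x = ∑ i ∈ S, x i := by
  simp [indicatorVec, dotProduct]

theorem sum_eq_zero_of_mem_dualCode [Fintype ι] [DecidableEq ι] {F : Finset (Finset ι)}
    {x : ι → ZMod 2} (hx : x ∈ dualCode (codeSpannedBy F)) : ∀ S ∈ F, ∑ i ∈ S, x i = 0 := by
  intro S hS
  rw [← dotProduct_indicatorVec]
  exact hx _ (Submodule.subset_span ⟨S, hS, rfl⟩)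

end Codes

/-! ### Assembling the blocks and the main theorem. -/

/-- If every point lies on a block, the coordinates are in bijection with `m` copies of the seven
labels in such a way that the dual code consists of blocks of simplex words. -/
theorem exists_equiv_blocks {ι : Type*} [DecidableEq ι] [Fintype ι] {F : Finset (Finset ι)}
    (hF : IsTripleConfiguration F) (hB : ∀ i, ∃ B, IsBlock F B ∧ i ∈ B) {m : ℕ}
    (hm : Fintype.card ι = 7 * m) :
    ∃ e : ι ≃ Fin m × Fin 7, ∀ x : Fin m × Fin 7 → ZMod 2,
      x ∘ e ∈ dualCode (codeSpannedBy F) → x ∈ directSumCopies m simplexCode := by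
  classical
  let β := {B : Finset ι // IsBlock F B}
  choose v hinj hmem hcode using fun B : β => B.2.exists_labelling hF
  have hbij : Function.Bijective fun p : β × Fin 7 => v p.1 p.2 := by
    constructor
    · rintro ⟨B, k⟩ ⟨B', k'⟩ h
      have h' : v B k = v B' k' := h
      have hBB : B = B' := Subtype.ext
        (B.2.eq_of_mem hF B'.2 (hmem B k) (by rw [h']; exact hmem B' k'))
      subst hBB
      rw [hinj B h']
    · intro i
      obtain ⟨B, hB, hi⟩ := hB i
      have himg : Finset.univ.image (v ⟨B, hB⟩) = B := by
        refine Finset.eq_of_subset_of_card_le ?_ ?_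
        · intro j hj
          obtain ⟨k, -, rfl⟩ := Finset.mem_image.1 hj
          exact hmem ⟨B, hB⟩ k
        · rw [Finset.card_image_of_injective _ (hinj _), hB.1]
          simp
      rw [← himg] at hi
      obtain ⟨k, -, rfl⟩ := Finset.mem_image.1 hi
      exact ⟨(⟨B, hB⟩, k), rfl⟩
  have hcard : Fintype.card β = m := by
    have h := Fintype.card_of_bijective hbij
    rw [Fintype.card_prod, Fintype.card_fin, hm] at h
    omega
  let E : β × Fin 7 ≃ ι := Equiv.ofBijective _ hbij
  let E' : β ≃ Fin m := Fintype.equivFinOfCardEq hcard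
  refine ⟨E.symm.trans (E'.prodCongr (Equiv.refl _)), fun x hx j => ?_⟩
  have h := hcode (E'.symm j) _ (sum_eq_zero_of_mem_dualCode hx)
  convert h using 1
  funext k
  have : E.symm (v (E'.symm j) k) = (E'.symm j, k) := by
    rw [Equiv.symm_apply_eq]
    rfl
  simp [this]

theorem mainTheorem1 (m : ℕ) (hm : 0 < m)
    (F : Finset (Finset (Fin (7 * m))))
    (hcard : F.card = 7 * m)
    (hthree : ∀ S ∈ F, S.card = 3)
    (hcover : ∀ i : Fin (7 * m), CoversWithAvailability 2 3 F i) :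
    codeRate (dualCode (codeSpannedBy F)) ≤ 3 / 7 ∧
    (codeRate (dualCode (codeSpannedBy F)) = 3 / 7 ↔
      CodeEquivalent (dualCode (codeSpannedBy F)) (directSumCopies m simplexCode)) ∧
    (codeRate (dualCode (codeSpannedBy F)) = 3 / 7 ↔
      CodeEquivalent (codeSpannedBy F) (directSumCopies m hammingCode)) := by
  have hF := isTripleConfiguration_of_covers (by simpa using hcard) hthree hcover
  set C := codeSpannedBy F
  have hW : ∀ x ∈ dualCode C, ∀ S ∈ F, ∑ i ∈ S, x i = 0 :=
    fun x hx => sum_eq_zero_of_mem_dualCode hx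
  have hbound := fourteen_mul_finrank_le hF hW
  rw [hcard, Fintype.card_fin] at hbound
  have hmR : (0 : ℝ) < m := Nat.cast_pos.2 hm
  have hrate : codeRate (dualCode C) = 3 / 7 ↔
      Module.finrank (ZMod 2) (dualCode C) = 3 * m := by
    rw [codeRate, Fintype.card_fin, div_eq_div_iff (by positivity) (by norm_num),
      ← @Nat.cast_inj ℝ]
    push_cast
    constructor <;> intro h <;> linarith
  have hsimplex : Module.finrank (ZMod 2) (directSumCopies m simplexCode) = 3 * m := by
    rw [finrank_directSumCopies, finrank_simplexCode, mul_comm]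
  have hi : codeRate (dualCode C) = 3 / 7 ↔
      CodeEquivalent (dualCode C) (directSumCopies m simplexCode) := by
    rw [hrate]
    refine ⟨fun h => ?_, fun h => h.finrank_eq.trans hsimplex⟩
    obtain ⟨e, he⟩ := exists_equiv_blocks hF
      (exists_isBlock hF hW (by rw [h, hcard, Fintype.card_fin]; ring)) (Fintype.card_fin _)
    set D : BinaryCode (Fin m × Fin 7) :=
      (dualCode C).comap (LinearEquiv.funCongrLeft (ZMod 2) (ZMod 2) e).toLinearMap with hD
    have hCD : CodeEquivalent (dualCode C) D := ⟨e, fun x => Iff.rfl⟩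
    -- The blocks give only an inclusion; both sides have dimension 3m.
    have hDe : D = directSumCopies m simplexCode :=
      Submodule.eq_of_le_of_finrank_eq (fun x hx => he x hx)
        (by rw [← hCD.finrank_eq, h, hsimplex])
    exact hDe ▸ hCD
  refine ⟨?_, hi, hi.trans ⟨fun h => ?_, fun h => ?_⟩⟩
  · have h3 : Module.finrank (ZMod 2) (dualCode C) ≤ 3 * m := by omega
    have h3' : (Module.finrank (ZMod 2) (dualCode C) : ℝ) ≤ 3 * m := by exact_mod_cast h3
    rw [codeRate, Fintype.card_fin, div_le_div_iff₀ (by positivity) (by norm_num)]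
    push_cast
    linarith
  · have h' := h.dual
    rwa [dualCode_dualCode, dualCode_directSumCopies, dualCode_simplexCode] at h'
  · have h' := h.dual
    rwa [← dualCode_simplexCode, ← dualCode_directSumCopies, dualCode_dualCode] at h'
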